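/- For $n\ge 0$, let $I_n(3412)$ be the set of permutations $\pi$ of $\{1,\dots,n\}$ with $\pi(\pi(i))=i$ for all $i$ which avoid $3412$, that is, for which there are no positions $i_1<i_2<i_3<i_4$ with $\pi(i_3)<\pi(i_4)<\pi(i_1)<\pi(i_2)$. Let $I(3412)=\bigcup_{n\ge 0} I_n(3412)$, which includes the empty permutation. For $k\ge 1$ and $\pi\in I(3412)$, let $\tau_k(\pi)$ be the number of decreasing subsequences of length $k$ in $\pi$. Let $x_1,x_2,\dots$ be commuting indeterminates. Then, in the ring $\mathbb Z[[x_1,x_2,\dots]]$ of formal power series, $$\sum_{\pi\in I(3412)}\ \prod_{k\ge 1} x_k^{\tau_k(\pi)} =\cfrac{1}{b_0-\cfrac{a_1}{b_1-\cfrac{a_2}{b_2-\cdots}}},$$ where $$a_n=\prod_{i=1}^{2n} x_i^{\binom{2n-2}{i-1}+\binom{2n-1}{i-1}}\quad(n\ge 1),\qquad b_n=1-\prod_{i=1}^{2n+1} x_i^{\binom{2n}{i-1}}\quad(n\ge 0),$$ with $\binom{m}{j}=0$ for $j>m$. Thus the right-hand side begins $$\cfrac{1}{1-x_1-\cfrac{x_1^2x_2}{1-x_1x_2^2x_3-\cfrac{x_1^2x_2^5x_3^4x_4}{1-x_1x_2^4x_3^6x_4^4x_5-\cdots}}}.$$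 Both sides are understood with respect to coefficientwise convergence of formal power series (each coefficient is eventually constant): the sum on the left converges, all denominators occurring in the finite truncations of the continued fraction are invertible power series, and these truncations converge to the sum on the left. -/

import Mathlib

open scoped MvPowerSeries.WithPiTopology

/-- `π` contains a subsequence of type `σ`: there are positions `f 0 < f 1 < ⋯ < f (k - 1)` at which
the entries of `π` have the same pairwise comparisons as the entries of `σ`. -/
def ContainsPattern {k n : ℕ} (σ : Equiv.Perm (Fin k)) (π : Equiv.Perm (Fin n)) : Prop :=
  ∃ f : Fin k → Fin n, StrictMono f ∧ ∀ i j : Fin k, π (f i) < π (f j) ↔ σ i < σ j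

/-- The permutation with one-line notation 3412; on `Fin 4 = {0, 1, 2, 3}` positions and entries
are both shifted down by one. -/
def perm3412 : Equiv.Perm (Fin 4) where
  toFun := ![2, 3, 0, 1]
  invFun := ![2, 3, 0, 1]
  left_inv := by decide
  right_inv := by decide

/-- The set `I(3412)` of all involutions, of any length `n ≥ 0`, which avoid 3412. -/
def I3412 : Type :=
  Σ n : ℕ, {π : Equiv.Perm (Fin n) // (∀ i, π (π i) = i) ∧ ¬ ContainsPattern perm3412 π}

open Classical in
/-- The number of decreasing subsequences of length `k` in `π`; a subsequence is given by its set of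
positions. -/
noncomputable def tau (k : ℕ) {n : ℕ} (π : Equiv.Perm (Fin n)) : ℕ :=
  ((Finset.powersetCard k (Finset.univ : Finset (Fin n))).filter
    (fun s => StrictAntiOn π (s : Set (Fin n)))).card

/-- The weight `∏_{k ≥ 1} x_k ^ τ_k(π)`. Only finitely many factors differ from `1`, since
`τ_k(π) = 0` when `k` exceeds the length of `π`. -/
noncomputable def permWeight (π : I3412) : MvPowerSeries ℕ+ ℤ :=
  ∏ᶠ k : ℕ+, (MvPowerSeries.X k : MvPowerSeries ℕ+ ℤ) ^ tau (k : ℕ) π.2.1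

/-- The finite continued fraction
`a m / (b m + a (m+1) / (b (m+1) + ⋯ + a (m+n-1) / b (m+n-1)))` with `n` levels, starting at
level `m`; it is `0` if there are no levels. -/
noncomputable def finiteCF {A : Type*} [CommRing A] (a b : ℕ → A) : ℕ → ℕ → A
  | 0, _ => 0
  | n + 1, m => a m * Ring.inverse (b m + finiteCF a b n (m + 1))

/-- `F` is the value of the infinite continued fraction `a 0 / (b 0 + a 1 / (b 1 + a 2 / ⋯))`: every
denominator which occurs in its finite truncations is invertible, and the truncations
tend to `F`. -/
def HasContFrac {A : Type*} [CommRing A] [TopologicalSpace A] (a b : ℕ → A) (F : A) : Prop :=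
  (∀ n m : ℕ, IsUnit (b m + finiteCF a b n (m + 1))) ∧
    Filter.Tendsto (fun n => finiteCF a b n 0) Filter.atTop (nhds F)

/-- `∏_{i=1}^{2n} x_i ^ (C(2n-2, i-1) + C(2n-1, i-1))`, for `n ≥ 1`, with the product indexed by
`j = i - 1`. -/
noncomputable def cfNumerator (n : ℕ) : MvPowerSeries ℕ+ ℤ :=
  ∏ j ∈ Finset.range (2 * n),
    (MvPowerSeries.X j.succPNat : MvPowerSeries ℕ+ ℤ) ^
      ((2 * n - 2).choose j + (2 * n - 1).choose j)

/-- `1 - ∏_{i=1}^{2n+1} x_i ^ C(2n, i-1)`, for `n ≥ 0`, with the product indexed by `j = i - 1`. -/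
noncomputable def cfDenominator (n : ℕ) : MvPowerSeries ℕ+ ℤ :=
  1 - ∏ j ∈ Finset.range (2 * n + 1),
    (MvPowerSeries.X j.succPNat : MvPowerSeries ℕ+ ℤ) ^ (2 * n).choose j

/-!
An involution contains 3412 exactly when two of its transpositions cross, that is, when
`i < j < π i < π j` for some `i` and `j` (`noncrossingOn_extendPerm`,
`not_containsPattern_of_noncrossingOn`). A noncrossing involution is empty, or a fixed point
followed by a noncrossing involution, or a transposition enclosing one noncrossing involution and
followed by another one. So `I3412` is in bijection with Motzkin trees (`I3412.toTree_injective`,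
`I3412.toTree_surjective`).

Juxtaposition adds the numbers of nonempty decreasing subsequences (`antiCount_union`). The
endpoints of a transposition extend every decreasing subsequence of the involution which it
encloses (`antiCount_insert`). Hence an involution inside `d` nested transpositions, if only the
decreasing subsequences meeting it are counted, has a weight that is a product over its points and
transpositions: a fixed point at depth `d` contributes `1 - b_d`, and a transposition at depth `d`
contributes `a_(d+1)` (`MotzkinTree.weight`, `permWeight_eq_weight`).

The generating functions `F_d` of these weights therefore satisfy
`F_d = 1 + (1 - b_d) F_d + a_(d+1) F_(d+1) F_d`, that is, `F_d = 1 / (b_d - a_(d+1) F_(d+1))`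
(`MotzkinTree.genFun_eq`, `MotzkinTree.genFun_mul`). Replacing a tail of the continued fraction by
its truncation makes an error that is multiplied by `a_m` on passing to level `m`
(`mul_dvd_finiteCF_succ_sub`). As `x_1` divides each `a_m`, the truncations converge to `F_0`. The
exponent of `x_1` in a weight is the number of points, which makes all the sums converge.
-/

/-! ### Motzkin trees and noncrossing involutions -/

/-- Motzkin trees, which encode noncrossing involutions of an interval read from left to right:
`fix t` starts with a fixed point followed by `t`, and `arc s t` starts with a transposition
enclosing `s` and followed by `t`. -/
inductive MotzkinTree : Type
  | nil : MotzkinTree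
  | fix (t : MotzkinTree) : MotzkinTree
  | arc (s t : MotzkinTree) : MotzkinTree

namespace MotzkinTree

/-- The number of points of the encoded involution. -/
def size : MotzkinTree → ℕ
  | nil => 0
  | fix t => t.size + 1
  | arc s t => s.size + t.size + 2

/-- `t.Encodes f a` says that `f`, on the interval `[a, a + t.size)`, is the involution
encoded by `t`. -/
def Encodes : MotzkinTree → (ℕ → ℕ) → ℕ → Prop
  | nil, _, _ => True
  | fix t, f, a => f a = a ∧ t.Encodes f (a + 1)
  | arc s t, f, a =>
      f a = a + s.size + 1 ∧ f (a + s.size + 1) = a ∧ s.Encodes f (a + 1) ∧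
        t.Encodes f (a + s.size + 2)

end MotzkinTree

/-- `f` restricts to an involution of the interval `[a, b)` no two of whose transpositions
cross. -/
def NoncrossingOn (f : ℕ → ℕ) (a b : ℕ) : Prop :=
  (∀ x, a ≤ x → x < b → a ≤ f x ∧ f x < b ∧ f (f x) = x) ∧
    ∀ i j, a ≤ i → i < j → j < f i → f i < f j → f j < b → False

theorem exists_encodes_of_noncrossingOn {f : ℕ → ℕ} (n : ℕ) :
    ∀ a, NoncrossingOn f a (a + n) → ∃ t : MotzkinTree, t.size = n ∧ t.Encodes f a := by
  induction n using Nat.strong_induction_on with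
  | _ n ih =>
    intro a ⟨hinv, hcr⟩
    rcases Nat.eq_zero_or_pos n with rfl | hn
    · exact ⟨.nil, rfl, trivial⟩
    obtain ⟨h1, h2, h3⟩ := hinv a le_rfl (by omega)
    rcases h1.eq_or_lt with h | h
    · obtain ⟨t, ht, ht'⟩ := ih (n - 1) (by omega) (a + 1) (by
        refine ⟨fun x hx hxn => ?_, fun i j hi hij hj hlt hb =>
          hcr i j (by omega) hij hj hlt (by omega)⟩
        have := hinv x (by omega) (by omega)
        have hne : f x ≠ a := fun he => by rw [he] at this; omega
        omega)
      exact ⟨.fix t, by simp only [MotzkinTree.size]; omega, h.symm, ht'⟩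
    · obtain ⟨c, hc⟩ : ∃ c, f a = a + c + 1 := ⟨f a - a - 1, by omega⟩
      rw [hc] at h h2 h3
      -- no other point is sent to an endpoint of the transposition that contains `a`
      have hne : ∀ x, a < x → x < a + n → x ≠ a + c + 1 → f x ≠ a ∧ f x ≠ a + c + 1 := by
        intro x hx hxn hxc
        have := (hinv x hx.le hxn).2.2
        exact ⟨fun he => by rw [he] at this; omega, fun he => by rw [he] at this; omega⟩
      have hin : ∀ x, a < x → x < a + c + 1 → a < f x ∧ f x < a + c + 1 := by
        intro x hx hxc
        have h4 := hinv x hx.le (by omega)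
        have h5 := hne x hx (by omega) (by omega)
        have h6 : ¬ f a < f x := fun h6 => hcr a x le_rfl hx (by omega) h6 h4.2.1
        omega
      obtain ⟨s, hs, hs'⟩ := ih c (by omega) (a + 1) (by
        refine ⟨fun x hx hxn => ?_, fun i j hi hij hj hlt hb =>
          hcr i j (by omega) hij hj hlt (by omega)⟩
        have h4 := hinv x (by omega) (by omega)
        have h5 := hin x (by omega) (by omega)
        omega)
      obtain ⟨t, ht, ht'⟩ := ih (n - c - 2) (by omega) (a + c + 2) (by
        refine ⟨fun x hx hxn => ?_, fun i j hi hij hj hlt hb =>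
          hcr i j (by omega) hij hj hlt (by omega)⟩
        have h4 := hinv x (by omega) (by omega)
        have h5 := hne x (by omega) (by omega) (by omega)
        have h6 : ¬ f x < a + c + 1 := fun h6 => by
          have := hin (f x) (by omega) h6
          omega
        omega)
      refine ⟨.arc s t, by simp only [MotzkinTree.size]; omega, ?_, ?_, hs', ?_⟩ <;>
        rw [hs] <;> assumption

namespace MotzkinTree

theorem Encodes.noncrossingOn {f : ℕ → ℕ} {t : MotzkinTree} :
    ∀ {a}, t.Encodes f a → NoncrossingOn f a (a + t.size) := by
  induction t with
  | nil => exact fun _ => ⟨fun x _ _ => by simp only [size] at *; omega,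
      fun i j _ _ _ _ _ => by simp only [size] at *; omega⟩
  | fix t ih =>
    intro a ⟨h1, h2⟩
    obtain ⟨h3, h4⟩ := ih h2
    simp only [size]
    refine ⟨fun x hx hxn => ?_, fun i j hi hij hj hlt hb => ?_⟩
    · rcases hx.eq_or_lt with rfl | hx
      · rw [h1, h1]; omega
      · have := h3 x hx (by omega)
        omega
    · rcases hi.eq_or_lt with rfl | hi
      · omega
      · exact h4 i j hi hij hj hlt (by omega)
  | arc s t ihs iht =>
    intro a ⟨h1, h2, hs, ht⟩
    obtain ⟨hs1, hs2⟩ := ihs hs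
    obtain ⟨ht1, ht2⟩ := iht ht
    simp only [size]
    set c := s.size
    set d := t.size
    have cases : ∀ x, a ≤ x → x < a + (c + d + 2) → x = a ∨ x = a + c + 1 ∨
        (a + 1 ≤ x ∧ x < a + 1 + c) ∨ (a + c + 2 ≤ x ∧ x < a + c + 2 + d) := by omega
    have hinv : ∀ x, a ≤ x → x < a + (c + d + 2) →
        a ≤ f x ∧ f x < a + (c + d + 2) ∧ f (f x) = x := by
      intro x hx hxn
      rcases cases x hx hxn with rfl | rfl | h | h
      · rw [h1, h2]; omega
      · rw [h2, h1]; omega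
      · have := hs1 x h.1 h.2
        omega
      · have := ht1 x h.1 h.2
        omega
    refine ⟨hinv, fun i j hi hij hj hlt hb => ?_⟩
    rcases cases i hi (by omega) with rfl | rfl | h | h
    · have := hs1 j (by omega) (by omega)
      omega
    · omega
    · have h3 := hs1 i h.1 h.2
      have h4 := hs1 j (by omega) (by omega)
      exact hs2 i j (by omega) hij hj hlt (by omega)
    · exact ht2 i j (by omega) hij hj hlt (by omega)

theorem Encodes.congr {f g : ℕ → ℕ} {t : MotzkinTree} :
    ∀ {a}, t.Encodes f a → (∀ x, a ≤ x → x < a + t.size → f x = g x) → t.Encodes g a := by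
  induction t with
  | nil => exact fun _ _ => trivial
  | fix t ih =>
    intro a ⟨h1, h2⟩ h
    simp only [size] at h
    exact ⟨by rw [← h a le_rfl (by omega), h1],
      ih h2 fun x hx hxn => h x (by omega) (by omega)⟩
  | arc s t ihs iht =>
    intro a ⟨h1, h2, hs, ht⟩ h
    simp only [size] at h
    exact ⟨by rw [← h a le_rfl (by omega), h1], by rw [← h _ (by omega) (by omega), h2],
      ihs hs fun x hx hxn => h x (by omega) (by omega),
      iht ht fun x hx hxn => h x (by omega) (by omega)⟩

theorem exists_encodes (t : MotzkinTree) : ∀ a, ∃ f, t.Encodes f a := by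
  induction t with
  | nil => exact fun _ => ⟨id, trivial⟩
  | fix t ih =>
    intro a
    obtain ⟨f, hf⟩ := ih (a + 1)
    refine ⟨fun x => if x = a then a else f x, by simp, hf.congr fun x hx _ => ?_⟩
    rw [if_neg (by omega)]
  | arc s t ihs iht =>
    intro a
    obtain ⟨f, hf⟩ := ihs (a + 1)
    obtain ⟨g, hg⟩ := iht (a + s.size + 2)
    refine ⟨fun x => if x = a then a + s.size + 1 else if x = a + s.size + 1 then a else
      if x < a + s.size + 1 then f x else g x, by simp, ?_, hf.congr fun x hx hxn => ?_,
      hg.congr fun x hx hxn => ?_⟩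
    · dsimp only
      rw [if_neg (by omega), if_pos rfl]
    · rw [if_neg (by omega), if_neg (by omega), if_pos (by omega)]
    · rw [if_neg (by omega), if_neg (by omega), if_neg (by omega)]

theorem Encodes.tree_unique {f : ℕ → ℕ} {t : MotzkinTree} :
    ∀ {a t'}, t.Encodes f a → t'.Encodes f a → t.size = t'.size → t = t' := by
  induction t with
  | nil => rintro a (_ | t' | ⟨s', t'⟩) <;> simp [size]
  | fix t ih =>
    rintro a (_ | t' | ⟨s', t'⟩) ⟨h1, h2⟩ h3 h4
    · simp [size] at h4
    · rw [ih h2 h3.2 (by simpa [size] using h4)]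
    · have := h3.1
      omega
  | arc s t ihs iht =>
    rintro a (_ | t' | ⟨s', t'⟩) ⟨h1, h2, h3, h4⟩ h5 h6
    · simp [size] at h6
    · have := h5.1
      omega
    · obtain ⟨g1, g2, g3, g4⟩ := h5
      simp only [size] at h6
      have hs : s.size = s'.size := by omega
      rw [← hs] at g4
      rw [ihs h3 g3 hs, iht h4 g4 (by omega)]

theorem Encodes.eqOn {f g : ℕ → ℕ} {t : MotzkinTree} :
    ∀ {a}, t.Encodes f a → t.Encodes g a → ∀ x, a ≤ x → x < a + t.size → f x = g x := by
  induction t with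
  | nil => intro a _ _ x h1 h2; simp only [size] at h2; omega
  | fix t ih =>
    intro a ⟨h1, h2⟩ ⟨g1, g2⟩ x hx hxn
    simp only [size] at hxn
    rcases hx.eq_or_lt with rfl | hx
    · rw [h1, g1]
    · exact ih h2 g2 x hx (by omega)
  | arc s t ihs iht =>
    intro a ⟨h1, h2, h3, h4⟩ ⟨g1, g2, g3, g4⟩ x hx hxn
    simp only [size] at hxn
    rcases hx.eq_or_lt with rfl | hx
    · rw [h1, g1]
    rcases lt_trichotomy x (a + s.size + 1) with h | rfl | h
    · exact ihs h3 g3 x hx (by omega)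
    · rw [h2, g2]
    · exact iht h4 g4 x (by omega) (by omega)

end MotzkinTree

/-! ### Involutions avoiding 3412 as Motzkin trees -/

/-- A permutation of `Fin n` as a function on `ℕ`, extended by the identity. -/
def extendPerm {n : ℕ} (π : Equiv.Perm (Fin n)) (x : ℕ) : ℕ :=
  if h : x < n then π ⟨x, h⟩ else x

theorem extendPerm_val {n : ℕ} (π : Equiv.Perm (Fin n)) (x : Fin n) :
    extendPerm π x = π x := by
  simp [extendPerm]

theorem extendPerm_injective {n : ℕ} {π ρ : Equiv.Perm (Fin n)}
    (h : ∀ x < n, extendPerm π x = extendPerm ρ x) : π = ρ := by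
  ext x
  rw [← extendPerm_val, ← extendPerm_val, h x x.2]

/-- Two crossing transpositions `i < j < π i < π j` form a subsequence of type 3412. -/
theorem noncrossingOn_extendPerm {n : ℕ} {π : Equiv.Perm (Fin n)} (hinv : ∀ i, π (π i) = i)
    (hav : ¬ ContainsPattern perm3412 π) : NoncrossingOn (extendPerm π) 0 (0 + n) := by
  rw [Nat.zero_add]
  refine ⟨fun x _ hx => ?_, fun i j _ hij hj hlt hb => ?_⟩
  · lift x to Fin n using hx
    simp [extendPerm_val, hinv]
  · have hi : i < n := by omega
    have hjn : j < n := by omega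
    lift i to Fin n using hi
    lift j to Fin n using hjn
    simp only [extendPerm_val, Fin.val_fin_lt] at hij hj hlt
    refine hav ⟨![i, j, π i, π j], ?_, ?_⟩
    · rw [Fin.strictMono_iff_lt_succ]
      intro k
      fin_cases k <;> simpa
    · intro k l
      have := hij.trans hj
      have := hj.trans hlt
      have := hij.trans (hj.trans hlt)
      fin_cases k <;> fin_cases l <;> simp [perm3412, *, le_of_lt]

/-- Let `i₁ < i₂ < i₃ < i₄` be the positions of a subsequence of type 3412. If `π i₄ < i₃`, then
`π i₃ < π i₄ < i₃ < i₄` is a crossing; otherwise `i₁ < i₂ < π i₁ < π i₂` is one. -/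
theorem not_containsPattern_of_noncrossingOn {n : ℕ} {π : Equiv.Perm (Fin n)}
    (h : NoncrossingOn (extendPerm π) 0 n) : ¬ ContainsPattern perm3412 π := by
  rintro ⟨f, hf, hp⟩
  obtain ⟨h1, h2⟩ := h
  have e : ∀ k, extendPerm π (f k) = π (f k) := fun k => extendPerm_val π (f k)
  have i1 := fun k => h1 (f k) (Nat.zero_le _) (f k).2
  have m01 : (f 0 : ℕ) < f 1 := hf (by decide)
  have m12 : (f 1 : ℕ) < f 2 := hf (by decide)
  have m23 : (f 2 : ℕ) < f 3 := hf (by decide)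
  have v23 : extendPerm π (f 2) < extendPerm π (f 3) := by
    rw [e, e]; exact (hp 2 3).2 (by decide)
  have v30 : extendPerm π (f 3) < extendPerm π (f 0) := by
    rw [e, e]; exact (hp 3 0).2 (by decide)
  have v01 : extendPerm π (f 0) < extendPerm π (f 1) := by
    rw [e, e]; exact (hp 0 1).2 (by decide)
  have c1 := h2 (f 0) (f 1) (Nat.zero_le _) m01
  have c2 := h2 (extendPerm π (f 2)) (extendPerm π (f 3)) (Nat.zero_le _) v23
  rw [(i1 2).2.2, (i1 3).2.2] at c2
  by_cases hq : extendPerm π (f 3) < f 2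
  · exact c2 hq m23 (f 3).2
  · exact c1 (by omega) v01 (i1 1).2.1

/-! ### Decreasing subsequences -/

open Classical in
/-- The number of `k`-element subsets of `S` on which `f` is strictly decreasing. -/
noncomputable def antiCount (f : ℕ → ℕ) (S : Finset ℕ) (k : ℕ) : ℕ :=
  ((Finset.powersetCard k S).filter (fun s : Finset ℕ => StrictAntiOn f (s : Set ℕ))).card

theorem antiCount_zero (f : ℕ → ℕ) (S : Finset ℕ) : antiCount f S 0 = 1 := by
  simp [antiCount, Finset.filter_singleton, StrictAntiOn]

theorem antiCount_empty_succ (f : ℕ → ℕ) (k : ℕ) : antiCount f ∅ (k + 1) = 0 := by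
  simp [antiCount]

open Classical in
/-- In the definition of `tau`, the sets of positions are coerced from `Finset (Fin n)` to
`Set (Fin n)` through the monad structure of `Finset`; the coercion being injective, this does not
affect the count. -/
theorem tau_eq_card_filter (k : ℕ) {n : ℕ} (π : Equiv.Perm (Fin n)) :
    tau k π = ((Finset.powersetCard k (Finset.univ : Finset (Fin n))).filter
      (fun s : Finset (Fin n) => StrictAntiOn π (s : Set (Fin n)))).card := by
  have h : tau k π = (((Finset.powersetCard k (Finset.univ : Finset (Fin n))).sup fun s =>
      ({(s : Set (Fin n))} : Finset (Set (Fin n)))).filter fun s => StrictAntiOn π s).card := rfl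
  rw [h, Finset.sup_singleton_apply, Finset.filter_image, Finset.card_image_of_injective _ Finset.coe_injective]
  congr!

theorem tau_eq_antiCount {n : ℕ} (π : Equiv.Perm (Fin n)) (k : ℕ) :
    tau k π = antiCount (extendPerm π) (Finset.range n) k := by
  classical
  have hr : Finset.range n = Finset.univ.map (Fin.valEmbedding (n := n)) := by
    ext x; simp
  rw [tau_eq_card_filter, antiCount, hr, Finset.powersetCard_map, Finset.filter_map, Finset.card_map]
  congr 1
  refine Finset.filter_congr fun s _ => ?_
  simp only [Function.comp, StrictAntiOn, Finset.mem_coe]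
  simp [extendPerm_val]

/-- A point `x` forming a decreasing pair with every point of `S` extends every decreasing
subsequence in `S`. -/
theorem antiCount_insert {f : ℕ → ℕ} {S : Finset ℕ} {x : ℕ}
    (h : ∀ y ∈ S, (x < y ∧ f y < f x) ∨ (y < x ∧ f x < f y)) (k : ℕ) :
    antiCount f (insert x S) (k + 1) = antiCount f S (k + 1) + antiCount f S k := by
  classical
  have hx : x ∉ S := fun hx => by rcases h x hx with h | h <;> omega
  rw [antiCount, Finset.powersetCard_succ_insert hx, Finset.filter_union,
    Finset.card_union_of_disjoint]
  · congr 1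
    rw [Finset.filter_image, Finset.card_image_of_injOn]
    · rw [antiCount]
      congr 1
      refine Finset.filter_congr fun s hs => ⟨fun hs' => hs'.mono (by simp), fun hs' => ?_⟩
      have hsS := (Finset.mem_powersetCard.1 hs).1
      intro y hy z hz hyz
      rw [Finset.coe_insert, Set.mem_insert_iff] at hy hz
      rcases hy with rfl | hy <;> rcases hz with rfl | hz
      · omega
      · have := h z (hsS hz); omega
      · have := h y (hsS hy); omega
      · exact hs' hy hz hyz
    · intro s hs t ht hst
      have hs : s ⊆ S := (Finset.mem_powersetCard.1 (Finset.mem_filter.1 hs).1).1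
      have ht : t ⊆ S := (Finset.mem_powersetCard.1 (Finset.mem_filter.1 ht).1).1
      have := congrArg (Finset.erase · x) hst
      simpa [Finset.erase_insert, mt (@hs x) hx, mt (@ht x) hx] using this
  · refine Finset.disjoint_left.2 fun s hs ht => hx ?_
    obtain ⟨t, -, rfl⟩ := Finset.mem_image.1 (Finset.mem_filter.1 ht).1
    exact (Finset.mem_powersetCard.1 (Finset.mem_filter.1 hs).1).1 (Finset.mem_insert_self x t)

/-- If `S` lies entirely to the left of and below `T`, then a nonempty decreasing subsequence in
`S ∪ T` stays in one of the two. -/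
theorem antiCount_union {f : ℕ → ℕ} {S T : Finset ℕ}
    (h : ∀ x ∈ S, ∀ y ∈ T, x < y ∧ f x < f y) (k : ℕ) :
    antiCount f (S ∪ T) (k + 1) = antiCount f S (k + 1) + antiCount f T (k + 1) := by
  classical
  rw [antiCount, antiCount, antiCount, ← Finset.card_union_of_disjoint]
  · congr 1
    ext s
    simp only [Finset.mem_union, Finset.mem_filter, Finset.mem_powersetCard]
    constructor
    · rintro ⟨⟨hs, hc⟩, ha⟩
      by_cases hT : s ⊆ T
      · exact Or.inr ⟨⟨hT, hc⟩, ha⟩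
      · refine Or.inl ⟨⟨fun y hy => ?_, hc⟩, ha⟩
        obtain ⟨x, hx, hxT⟩ := Finset.not_subset.1 hT
        have hxS := (Finset.mem_union.1 (hs hx)).resolve_right hxT
        refine (Finset.mem_union.1 (hs hy)).resolve_right fun hyT => ?_
        have := h x hxS y hyT
        exact lt_asymm this.2 (ha hx hy this.1)
    · rintro (⟨⟨hs, hc⟩, ha⟩ | ⟨⟨hs, hc⟩, ha⟩)
      · exact ⟨⟨hs.trans Finset.subset_union_left, hc⟩, ha⟩
      · exact ⟨⟨hs.trans Finset.subset_union_right, hc⟩, ha⟩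
  · refine Finset.disjoint_left.2 fun s hs ht => ?_
    obtain ⟨hs, hc⟩ := Finset.mem_powersetCard.1 (Finset.mem_filter.1 hs).1
    have ht := (Finset.mem_powersetCard.1 (Finset.mem_filter.1 ht).1).1
    obtain ⟨x, hx⟩ := Finset.card_pos.1 (hc.symm ▸ Nat.succ_pos k : 0 < s.card)
    exact lt_irrefl _ (h x (hs hx) x (ht hx)).1

/-! ### Exponents of the weights -/

namespace MotzkinTree

/-- The exponent of `x_(i+1)` in the weight of the involution encoded by a tree, when it is placed
inside `d` nested transpositions and only decreasing subsequences which meet it are counted. Each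
of these consists of a nonempty decreasing subsequence and a subset of the `2 * d` endpoints of the
enclosing transpositions. -/
def expo : ℕ → MotzkinTree → ℕ → ℕ
  | _, nil, _ => 0
  | d, fix t, i => (2 * d).choose i + t.expo d i
  | d, arc s t, i => ((2 * d).choose i + (2 * d + 1).choose i) + s.expo (d + 1) i + t.expo d i

theorem expo_succ_zero (t : MotzkinTree) : ∀ d, t.expo (d + 1) 0 = t.expo d 0 := by
  induction t with
  | nil => exact fun _ => rfl
  | fix t ih => intro d; simp [expo, ih]
  | arc s t ihs iht => intro d; simp [expo, ihs, iht]

theorem expo_succ_one (t : MotzkinTree) :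
    ∀ d, t.expo (d + 1) 1 = t.expo d 1 + 2 * t.expo d 0 := by
  induction t with
  | nil => exact fun _ => rfl
  | fix t ih => intro d; simp [expo, ih]; ring
  | arc s t ihs iht => intro d; simp [expo, ihs, iht]; ring

theorem expo_succ_add_two (t : MotzkinTree) (i : ℕ) :
    ∀ d, t.expo (d + 1) (i + 2) = t.expo d (i + 2) + 2 * t.expo d (i + 1) + t.expo d i := by
  have h : ∀ m, (m + 2).choose (i + 2) = m.choose (i + 2) + 2 * m.choose (i + 1) + m.choose i := by
    intro m
    rw [Nat.choose_succ_succ' (m + 1), Nat.choose_succ_succ' m, Nat.choose_succ_succ' m]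
    ring
  induction t with
  | nil => exact fun _ => rfl
  | fix t ih =>
    intro d
    simp only [expo, ih, Nat.mul_succ, h]
    ring
  | arc s t ihs iht =>
    intro d
    simp only [expo, ihs, iht, Nat.mul_succ, h, add_right_comm (2 * d) 2 1]
    ring

theorem expo_eq_zero_of_le (t : MotzkinTree) :
    ∀ d i, 2 * d + t.size ≤ i → t.expo d i = 0 := by
  induction t with
  | nil => exact fun _ _ _ => rfl
  | fix t ih =>
    intro d i h
    simp only [size] at h
    rw [expo, Nat.choose_eq_zero_of_lt (by omega), ih d i (by omega)]
  | arc s t ihs iht =>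
    intro d i h
    simp only [size] at h
    rw [expo, Nat.choose_eq_zero_of_lt (by omega), Nat.choose_eq_zero_of_lt (by omega),
      ihs _ i (by omega), iht d i (by omega)]

theorem Encodes.antiCount_eq_expo {f : ℕ → ℕ} {t : MotzkinTree} :
    ∀ {a}, t.Encodes f a → ∀ i, antiCount f (Finset.Ico a (a + t.size)) (i + 1) = t.expo 0 i := by
  induction t with
  | nil => intro a _ i; simp [size, expo, antiCount_empty_succ]
  | fix t ih =>
    intro a ⟨h1, h2⟩ i
    have h3 := h2.noncrossingOn.1
    have hS : Finset.Ico a (a + (t.size + 1)) =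
        insert a ∅ ∪ Finset.Ico (a + 1) (a + 1 + t.size) := by
      ext x; simp; omega
    rw [size, hS, antiCount_union, antiCount_insert (by simp), ih h2, antiCount_empty_succ, expo]
    · cases i <;> simp [antiCount_zero, antiCount_empty_succ]
    · simp only [insert_empty_eq, Finset.mem_singleton, Finset.mem_Ico, forall_eq, h1]
      intro y hy
      have := h3 y hy.1 hy.2
      omega
  | arc s t ihs iht =>
    intro a ⟨h1, h2, hs, ht⟩ i
    have h3 := hs.noncrossingOn.1
    have h4 := ht.noncrossingOn.1
    have hS : Finset.Ico a (a + (s.size + t.size + 2)) =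
        insert a (insert (a + s.size + 1) (Finset.Ico (a + 1) (a + 1 + s.size))) ∪
          Finset.Ico (a + s.size + 2) (a + s.size + 2 + t.size) := by
      ext x
      simp only [Finset.mem_Ico, Finset.mem_union, Finset.mem_insert]
      omega
    have hc : ∀ y ∈ Finset.Ico (a + 1) (a + 1 + s.size),
        (a + s.size + 1 < y ∧ f y < f (a + s.size + 1)) ∨
          (y < a + s.size + 1 ∧ f (a + s.size + 1) < f y) := by
      intro y hy
      rw [Finset.mem_Ico] at hy
      have := h3 y hy.1 hy.2
      omega
    rw [size, hS, antiCount_union, antiCount_insert, antiCount_insert hc, iht ht, ihs hs, expo]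
    · rcases i with _ | _ | i
      · simp [antiCount_zero, expo_succ_zero]; ring
      · rw [antiCount_insert hc, ihs hs, antiCount_zero, expo_succ_one]
        simp; ring
      · rw [antiCount_insert hc, ihs hs, ihs hs, expo_succ_add_two,
          Nat.choose_eq_zero_of_lt (show 2 * 0 < i + 2 by omega),
          Nat.choose_eq_zero_of_lt (show 2 * 0 + 1 < i + 2 by omega)]
        ring
    · simp only [Finset.mem_insert, forall_eq_or_imp, Finset.mem_Ico]
      refine ⟨by omega, fun y hy => ?_⟩
      have := h3 y hy.1 hy.2
      omega
    · intro x hx y hy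
      simp only [Finset.mem_insert, Finset.mem_Ico] at hx hy
      have := h4 y hy.1 hy.2
      rcases hx with rfl | rfl | hx
      · omega
      · omega
      · have := h3 x hx.1 hx.2
        omega

end MotzkinTree

/-! ### The bijection with Motzkin trees -/

theorem I3412.exists_encodes (π : I3412) :
    ∃ t : MotzkinTree, t.size = π.1 ∧ t.Encodes (extendPerm π.2.1) 0 :=
  exists_encodes_of_noncrossingOn _ _ (noncrossingOn_extendPerm π.2.2.1 π.2.2.2)

/-- The Motzkin tree of an involution which avoids 3412. -/
noncomputable def I3412.toTree (π : I3412) : MotzkinTree := π.exists_encodes.choose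

theorem I3412.size_toTree (π : I3412) : π.toTree.size = π.1 := π.exists_encodes.choose_spec.1

theorem I3412.encodes_toTree (π : I3412) : π.toTree.Encodes (extendPerm π.2.1) 0 :=
  π.exists_encodes.choose_spec.2

theorem I3412.toTree_injective : Function.Injective I3412.toTree := by
  intro π ρ h
  have hn : π.1 = ρ.1 := by rw [← π.size_toTree, ← ρ.size_toTree, h]
  have hπ := π.encodes_toTree
  have hρ := ρ.encodes_toTree
  have hs := ρ.size_toTree
  rw [h] at hπ
  obtain ⟨n, π⟩ := π
  obtain ⟨m, ρ⟩ := ρ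
  obtain rfl : n = m := hn
  congr 1
  refine Subtype.ext (extendPerm_injective fun x hx => hπ.eqOn hρ x (Nat.zero_le x) ?_)
  rw [hs]
  simpa using hx

theorem I3412.toTree_surjective : Function.Surjective I3412.toTree := by
  intro t
  obtain ⟨f, hf⟩ := t.exists_encodes 0
  have hN := hf.noncrossingOn
  rw [Nat.zero_add] at hN
  have h1 := fun x : Fin t.size => hN.1 x (Nat.zero_le _) x.2
  let π : Equiv.Perm (Fin t.size) :=
    { toFun := fun x => ⟨f x, (h1 x).2.1⟩
      invFun := fun x => ⟨f x, (h1 x).2.1⟩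
      left_inv := fun x => Fin.ext (h1 x).2.2
      right_inv := fun x => Fin.ext (h1 x).2.2 }
  have hπ : ∀ x < t.size, f x = extendPerm π x := fun x hx => by simp [extendPerm, hx, π]
  have hN' : NoncrossingOn (extendPerm π) 0 t.size := by
    refine ⟨fun x hx hxn => ?_, fun i j hi hij hj hlt hb => ?_⟩
    · have := hN.1 x hx hxn
      rw [← hπ x hxn, ← hπ _ this.2.1]
      exact this
    · by_cases hin : i < t.size ∧ j < t.size
      · rw [← hπ i hin.1] at hj hlt
        rw [← hπ j hin.2] at hlt hb
        exact hN.2 i j hi hij hj hlt hb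
      · omega
  let ρ : I3412 := ⟨t.size, π, fun x => Fin.ext (h1 x).2.2,
    not_containsPattern_of_noncrossingOn hN'⟩
  exact ⟨ρ, ρ.encodes_toTree.tree_unique (hf.congr fun x _ hx => hπ x (by omega)) ρ.size_toTree⟩

theorem I3412.tau_eq_expo (π : I3412) (i : ℕ) : tau (i + 1) π.2.1 = π.toTree.expo 0 i := by
  rw [tau_eq_antiCount, ← π.encodes_toTree.antiCount_eq_expo, π.size_toTree, Nat.zero_add,
    Finset.range_eq_Ico]

/-! ### Weights of Motzkin trees -/

theorem eventually_cfNumerator_eq (d : ℕ) : ∀ᶠ N in Filter.atTop,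
    cfNumerator (d + 1) = ∏ j ∈ Finset.range N, (MvPowerSeries.X j.succPNat : MvPowerSeries ℕ+ ℤ) ^
      ((2 * d).choose j + (2 * d + 1).choose j) := by
  filter_upwards [Filter.eventually_ge_atTop (2 * (d + 1))] with N hN
  refine Finset.prod_subset (Finset.range_mono hN) fun j _ hj => ?_
  rw [Finset.mem_range] at hj
  rw [Nat.choose_eq_zero_of_lt (by omega), Nat.choose_eq_zero_of_lt (by omega), pow_zero]

theorem eventually_one_sub_cfDenominator_eq (d : ℕ) : ∀ᶠ N in Filter.atTop,
    1 - cfDenominator d = ∏ j ∈ Finset.range N,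
      (MvPowerSeries.X j.succPNat : MvPowerSeries ℕ+ ℤ) ^ (2 * d).choose j := by
  filter_upwards [Filter.eventually_ge_atTop (2 * d + 1)] with N hN
  rw [cfDenominator, sub_sub_cancel]
  refine Finset.prod_subset (Finset.range_mono hN) fun j _ hj => ?_
  rw [Finset.mem_range] at hj
  rw [Nat.choose_eq_zero_of_lt (by omega), pow_zero]

namespace MotzkinTree

/-- The weight of a tree inside `d` nested transpositions, as a product over its points and
transpositions: a fixed point at depth `d` contributes `1 - cfDenominator d`, and a transposition
at depth `d` contributes `cfNumerator (d + 1)`. -/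
noncomputable def weight : ℕ → MotzkinTree → MvPowerSeries ℕ+ ℤ
  | _, nil => 1
  | d, fix t => (1 - cfDenominator d) * t.weight d
  | d, arc s t => cfNumerator (d + 1) * s.weight (d + 1) * t.weight d

theorem eventually_weight_eq (t : MotzkinTree) : ∀ d, ∀ᶠ N in Filter.atTop,
    t.weight d =
      ∏ j ∈ Finset.range N, (MvPowerSeries.X j.succPNat : MvPowerSeries ℕ+ ℤ) ^ t.expo d j := by
  induction t with
  | nil => intro d; simp [weight, expo]
  | fix t ih =>
    intro d
    filter_upwards [eventually_one_sub_cfDenominator_eq d, ih d] with N h1 h2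
    simp only [weight, expo, pow_add, Finset.prod_mul_distrib] at *
    rw [h1, ← h2]
  | arc s t ihs iht =>
    intro d
    filter_upwards [eventually_cfNumerator_eq d, ihs (d + 1), iht d] with N h1 h2 h3
    simp only [weight, expo, pow_add, Finset.prod_mul_distrib] at *
    rw [h1, ← h2, ← h3]

end MotzkinTree

theorem permWeight_eq_weight (π : I3412) : permWeight π = π.toTree.weight 0 := by
  obtain ⟨N, hN, hle⟩ :=
    ((π.toTree.eventually_weight_eq 0).and (Filter.eventually_ge_atTop π.toTree.size)).exists
  have hinj : Function.Injective Nat.succPNat := Nat.succPNat_injective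
  rw [hN, permWeight,
    finprod_eq_prod_of_mulSupport_subset (s := (Finset.range N).map ⟨_, hinj⟩), Finset.prod_map]
  · exact Finset.prod_congr rfl fun j _ => by
      rw [← π.tau_eq_expo]; rfl
  · intro k hk
    obtain ⟨j, rfl⟩ : ∃ j, Nat.succPNat j = k := ⟨k.natPred, PNat.succPNat_natPred k⟩
    simp only [Finset.coe_map, Function.Embedding.coeFn_mk, Set.mem_image, Finset.mem_coe,
      Finset.mem_range]
    refine ⟨j, ?_, rfl⟩
    by_contra hj
    refine hk ?_
    have := π.tau_eq_expo j
    rw [π.toTree.expo_eq_zero_of_le 0 j (by omega)] at this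
    simp only [Nat.succPNat_coe, Nat.succ_eq_add_one, this, pow_zero]

/-! ### Divisibility by powers of the first variable -/

theorem X_one_sq_dvd_cfNumerator (d : ℕ) :
    (MvPowerSeries.X 1 : MvPowerSeries ℕ+ ℤ) ^ 2 ∣ cfNumerator (d + 1) := by
  have h := Finset.dvd_prod_of_mem (fun j => (MvPowerSeries.X j.succPNat : MvPowerSeries ℕ+ ℤ) ^
    ((2 * (d + 1) - 2).choose j + (2 * (d + 1) - 1).choose j))
    (Finset.mem_range.2 (show 0 < 2 * (d + 1) by omega))
  simp only [Nat.choose_zero_right] at h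
  exact h

theorem X_one_dvd_one_sub_cfDenominator (d : ℕ) :
    (MvPowerSeries.X 1 : MvPowerSeries ℕ+ ℤ) ∣ 1 - cfDenominator d := by
  rw [cfDenominator, sub_sub_cancel]
  have h := Finset.dvd_prod_of_mem (fun j => (MvPowerSeries.X j.succPNat : MvPowerSeries ℕ+ ℤ) ^
    (2 * d).choose j) (Finset.mem_range.2 (show 0 < 2 * d + 1 by omega))
  simp only [Nat.choose_zero_right, pow_one] at h
  exact h

namespace MotzkinTree

theorem X_one_pow_size_dvd_weight (t : MotzkinTree) :
    ∀ d, (MvPowerSeries.X 1 : MvPowerSeries ℕ+ ℤ) ^ t.size ∣ t.weight d := by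
  induction t with
  | nil => intro d; simp [size, weight]
  | fix t ih =>
    intro d
    rw [size, weight, pow_succ']
    exact mul_dvd_mul (X_one_dvd_one_sub_cfDenominator d) (ih d)
  | arc s t ihs iht =>
    intro d
    rw [size, weight, add_comm, pow_add, pow_add, ← mul_assoc]
    exact mul_dvd_mul (mul_dvd_mul (X_one_sq_dvd_cfNumerator d) (ihs _)) (iht d)

theorem finite_setOf_size_le (n : ℕ) : {t : MotzkinTree | t.size ≤ n}.Finite := by
  induction n with
  | zero =>
    refine (Set.finite_singleton nil).subset fun t ht => ?_
    rcases t with _ | t | ⟨s, t⟩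
    · rfl
    all_goals simp [size] at ht
  | succ n ih =>
    refine (((Set.finite_singleton nil).union (ih.image fix)).union
      (Set.Finite.image2 arc ih ih)).subset fun t ht => ?_
    rcases t with _ | t | ⟨s, t⟩
    · exact Or.inl (Or.inl rfl)
    · exact Or.inl (Or.inr ⟨t, by simpa [size] using ht, rfl⟩)
    · simp only [size, Set.mem_ofPred_eq] at ht
      exact Or.inr ⟨s, show s.size ≤ n by omega, t, show t.size ≤ n by omega, rfl⟩

end MotzkinTree

/-- A monomial can only occur in those members of the family for which `g i` is at most its
exponent in the first variable. -/
theorem summable_of_X_one_pow_dvd {ι : Type*} {f : ι → MvPowerSeries ℕ+ ℤ} (g : ι → ℕ)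
    (hg : ∀ n, {i | g i ≤ n}.Finite) (h : ∀ i, MvPowerSeries.X 1 ^ g i ∣ f i) : Summable f := by
  rw [MvPowerSeries.WithPiTopology.summable_iff_summable_coeff]
  refine fun m => summable_of_hasFiniteSupport ((hg (m 1)).subset fun i hi => ?_)
  by_contra hlt
  exact hi (MvPowerSeries.X_pow_dvd_iff.1 (h i) m (by simpa using hlt))

/-! ### The functional equation -/

namespace MotzkinTree

theorem summable_weight (d : ℕ) : Summable (weight d) :=
  summable_of_X_one_pow_dvd size finite_setOf_size_le fun t => t.X_one_pow_size_dvd_weight d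

/-- The generating function of the trees inside `d` nested transpositions. -/
noncomputable def genFun (d : ℕ) : MvPowerSeries ℕ+ ℤ := ∑' t, weight d t

theorem hasSum_weight (d : ℕ) : HasSum (weight d) (genFun d) := (summable_weight d).hasSum

theorem hasSum_weight_mul (d : ℕ) :
    HasSum (fun p : MotzkinTree × MotzkinTree => weight (d + 1) p.1 * weight d p.2)
      (genFun (d + 1) * genFun d) := by
  refine (hasSum_weight (d + 1)).mul (hasSum_weight d)
    (summable_of_X_one_pow_dvd (fun p => p.1.size + p.2.size) (fun n => ?_) fun p => ?_)
  · refine ((finite_setOf_size_le n).prod (finite_setOf_size_le n)).subset fun p hp => ?_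
    simp only [Set.mem_ofPred_eq] at hp
    exact ⟨show p.1.size ≤ n by omega, show p.2.size ≤ n by omega⟩
  · rw [pow_add]
    exact mul_dvd_mul (p.1.X_one_pow_size_dvd_weight _) (p.2.X_one_pow_size_dvd_weight _)

/-- Splitting a tree at its root. -/
def rootEquiv : Unit ⊕ (MotzkinTree ⊕ MotzkinTree × MotzkinTree) ≃ MotzkinTree where
  toFun := Sum.elim (fun _ => nil) (Sum.elim fix fun p => arc p.1 p.2)
  invFun
    | nil => Sum.inl ()
    | fix t => Sum.inr (Sum.inl t)
    | arc s t => Sum.inr (Sum.inr (s, t))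
  left_inv := by rintro (_ | _ | _) <;> rfl
  right_inv := by rintro (_ | _ | _) <;> rfl

theorem genFun_eq (d : ℕ) : genFun d =
    1 + ((1 - cfDenominator d) * genFun d +
      cfNumerator (d + 1) * (genFun (d + 1) * genFun d)) := by
  refine (hasSum_weight d).unique (rootEquiv.hasSum_iff.1 ?_)
  refine HasSum.sum ?_ (HasSum.sum ?_ ?_)
  · exact hasSum_unique _
  · exact (hasSum_weight d).mul_left _
  · simpa only [Function.comp_def, rootEquiv, Equiv.coe_fn_mk, Sum.elim_inr, weight, mul_assoc]
      using (hasSum_weight_mul d).mul_left (cfNumerator (d + 1))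

theorem genFun_mul (d : ℕ) :
    genFun d * (cfDenominator d + -cfNumerator (d + 1) * genFun (d + 1)) = 1 := by
  linear_combination genFun_eq d

end MotzkinTree

/-! ### Convergence of the continued fraction -/

/-- The partial numerators of the continued fraction, with their signs. -/
noncomputable def cfSignedNumerator (n : ℕ) : MvPowerSeries ℕ+ ℤ :=
  if n = 0 then 1 else -cfNumerator n

theorem isUnit_of_X_one_dvd_one_sub {φ : MvPowerSeries ℕ+ ℤ}
    (h : MvPowerSeries.X 1 ∣ 1 - φ) : IsUnit φ := by
  rw [MvPowerSeries.isUnit_iff_constantCoeff]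
  obtain ⟨ψ, hψ⟩ := h
  have := congrArg MvPowerSeries.constantCoeff hψ
  simp only [map_sub, map_one, map_mul, MvPowerSeries.constantCoeff_X, zero_mul] at this
  rw [← sub_eq_zero.1 this]
  exact isUnit_one

theorem X_one_dvd_finiteCF_succ (n m : ℕ) : (MvPowerSeries.X 1 : MvPowerSeries ℕ+ ℤ) ∣
    finiteCF cfSignedNumerator cfDenominator n (m + 1) := by
  cases n with
  | zero => exact dvd_zero _
  | succ n =>
    rw [finiteCF, cfSignedNumerator, if_neg (Nat.succ_ne_zero m)]
    exact ((Dvd.intro_left _ rfl).trans (X_one_sq_dvd_cfNumerator m)).neg_right.mul_right _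

theorem isUnit_cfDenominator_add_finiteCF (n m : ℕ) :
    IsUnit (cfDenominator m + finiteCF cfSignedNumerator cfDenominator n (m + 1)) := by
  refine isUnit_of_X_one_dvd_one_sub ?_
  rw [← sub_sub]
  exact dvd_sub (X_one_dvd_one_sub_cfDenominator m) (X_one_dvd_finiteCF_succ n m)

open MotzkinTree in
/-- The tail of the continued fraction at level `m` has the value
`cfSignedNumerator m * genFun m`. One more level of a truncation multiplies its error by the
partial numerator of that level. -/
theorem mul_dvd_finiteCF_succ_sub {n m : ℕ} {φ : MvPowerSeries ℕ+ ℤ}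
    (h : φ ∣ finiteCF cfSignedNumerator cfDenominator n (m + 1) -
      cfSignedNumerator (m + 1) * genFun (m + 1)) :
    cfSignedNumerator m * φ ∣ finiteCF cfSignedNumerator cfDenominator (n + 1) m -
      cfSignedNumerator m * genFun m := by
  have hu := Ring.inverse_mul_cancel _ (isUnit_cfDenominator_add_finiteCF n m)
  have hg := genFun_mul m
  rw [show -cfNumerator (m + 1) = cfSignedNumerator (m + 1) by simp [cfSignedNumerator]] at hg
  rw [finiteCF, ← mul_sub]
  refine mul_dvd_mul_left _ ?_
  set C := finiteCF cfSignedNumerator cfDenominator n (m + 1)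
  set u := Ring.inverse (cfDenominator m + C)
  -- the difference of inverses `1/x - 1/y = (y - x) / (x y)`
  have : u - genFun m =
      (C - cfSignedNumerator (m + 1) * genFun (m + 1)) * (-(u * genFun m)) := by
    linear_combination (-u) * hg + genFun m * hu
  rw [this]
  exact h.mul_right _

open MotzkinTree in
theorem X_one_pow_dvd_finiteCF_sub (n : ℕ) : ∀ m, (MvPowerSeries.X 1 : MvPowerSeries ℕ+ ℤ) ^ n ∣
    finiteCF cfSignedNumerator cfDenominator n (m + 1) -
      cfSignedNumerator (m + 1) * genFun (m + 1) := by
  induction n with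
  | zero => intro m; simp
  | succ n ih =>
    intro m
    refine dvd_trans ?_ (mul_dvd_finiteCF_succ_sub (ih (m + 1)))
    rw [pow_succ', cfSignedNumerator, if_neg (Nat.succ_ne_zero m)]
    exact mul_dvd_mul_right ((Dvd.intro_left _ rfl).trans (X_one_sq_dvd_cfNumerator m)).neg_right _

open MotzkinTree in
theorem tendsto_finiteCF_genFun :
    Filter.Tendsto (fun n => finiteCF cfSignedNumerator cfDenominator n 0) Filter.atTop
      (nhds (genFun 0)) := by
  rw [← Filter.tendsto_add_atTop_iff_nat 1,
    MvPowerSeries.WithPiTopology.tendsto_iff_coeff_tendsto]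
  intro k
  refine tendsto_const_nhds.congr' ?_
  filter_upwards [Filter.eventually_gt_atTop (k 1)] with n hn
  have h := mul_dvd_finiteCF_succ_sub (X_one_pow_dvd_finiteCF_sub n 0)
  rw [show cfSignedNumerator 0 = 1 from if_pos rfl, one_mul, one_mul] at h
  have := MvPowerSeries.X_pow_dvd_iff.1 h k hn
  rw [map_sub, sub_eq_zero] at this
  exact this.symm

theorem mainTheorem1 :
    ∃ F : MvPowerSeries ℕ+ ℤ,
      HasSum permWeight F ∧
      HasContFrac (fun n => if n = 0 then 1 else -cfNumerator n) cfDenominator F := by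
  refine ⟨MotzkinTree.genFun 0, ?_, isUnit_cfDenominator_add_finiteCF, tendsto_finiteCF_genFun⟩
  rw [funext permWeight_eq_weight]
  exact (Equiv.ofBijective I3412.toTree
    ⟨I3412.toTree_injective, I3412.toTree_surjective⟩).hasSum_iff.2 (MotzkinTree.hasSum_weight 0)
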